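/- Let $n\ge 1$, $p\ge 0$, let $\mathcal Z$ be a set of possible data points, $\Theta\subseteq\mathbb R^p$, and let $\Psi:\mathbb R^p\times\mathcal Z\to\mathbb R^p$ (for instance the gradient $\Psi(\theta,z)=\nabla_\theta\rho(\theta,z)$ of a loss function $\rho$) be measurable in its first argument and satisfy $\sup_{\theta\in\Theta,\,z\in\mathcal Z}\|\Psi(\theta,z)\|_2\le B_0$ for a constant $B_0>0$. Let $\gamma_1,\dots,\gamma_n\in\mathbb R$ be step sizes, let $\mu_1,\dots,\mu_n>0$, and let $\xi_1,\dots,\xi_n$ be i.i.d. standard Gaussian random vectors in $\mathbb R^p$. For an initial value $\hat\theta_0\in\mathbb R^p$ and a data set $(z_1,\dots,z_n)\in\mathcal Z^n$ define $$\hat\theta_i=\hat\theta_{i-1}-\gamma_i\Big\{\Psi(\hat\theta_{i-1},z_i)+\frac{2B_0}{\mu_i}\,\xi_i\Big\},\quad i=1,\dots,n,\qquad \bar\theta_n=\frac1n\sum_{i=1}^n\hat\theta_i .$$ Assume that for every data set $\hat\theta_0,\dots,\hat\theta_{n-1}$ lie in $\Theta$ almost surely (which is automatic if $\Theta=\mathbb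 R^p$). Then the randomized algorithm $(z_1,\dots,z_n)\mapsto\bar\theta_n$ is $\max\{\mu_1,\dots,\mu_n\}$-GDP. Here, for probability measures $P,Q$ on the same space and $\alpha\in[0,1]$, $T(P,Q)(\alpha)=\inf_\varphi\{1-\int\varphi\,dQ:\int\varphi\,dP\le\alpha\}$, the infimum being over measurable $\varphi$ with values in $[0,1]$; and a randomized algorithm $M$ is $\mu$-GDP ($\mu$-Gaussian differentially private) if, for all data sets $z,z'$ of the same size that differ in one entry and all $\alpha\in[0,1]$, the laws of the outputs satisfy $T(M(z),M(z'))(\alpha)\ge T(\mathcal N(0,1),\mathcal N(\mu,1))(\alpha)$. -/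

import Mathlib

open MeasureTheory ProbabilityTheory

noncomputable section

namespace LDPSGD

/-- A (randomized) test: a measurable function with values in `[0, 1]`, where `φ x` is the
probability of rejecting the null hypothesis after observing `x`. -/
def IsTest {X : Type*} [MeasurableSpace X] (φ : X → ℝ) : Prop :=
  Measurable φ ∧ ∀ x, φ x ∈ Set.Icc (0 : ℝ) 1

/-- The trade-off function `T(P, Q)`: the smallest type II error against the alternative `Q` among
all tests whose type I error under `P` is at most `α` (for `α ∈ [0, 1]`). -/
def tradeoff {X : Type*} [MeasurableSpace X] (P Q : Measure X) (α : ℝ) : ℝ :=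
  sInf {β : ℝ | ∃ φ : X → ℝ, IsTest φ ∧ ∫ x, φ x ∂P ≤ α ∧ β = ∫ x, (1 - φ x) ∂Q}

/-- `G_μ = T(N(0, 1), N(μ, 1))`. -/
def gaussianTradeoff (μ α : ℝ) : ℝ :=
  tradeoff (gaussianReal 0 1) (gaussianReal μ 1) α

/-- Two data sets of the same size differ in (at most) one entry. -/
def Neighboring {n : ℕ} {Z : Type*} (z z' : Fin n → Z) : Prop :=
  ∃ i, ∀ j, j ≠ i → z j = z' j

/-- `μ`-Gaussian differential privacy of a randomized algorithm, where `M z` is the law of the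
output on the data set `z`: `T(M z, M z') ≥ G_μ` on `[0, 1]` for all neighboring `z`, `z'`. -/
def IsGDP {n : ℕ} {Z X : Type*} [MeasurableSpace X] (μ : ℝ) (M : (Fin n → Z) → Measure X) : Prop :=
  ∀ z z' : Fin n → Z, Neighboring z z' →
    ∀ α ∈ Set.Icc (0 : ℝ) 1, gaussianTradeoff μ α ≤ tradeoff (M z) (M z') α

/-- The noisy SGD iterates `θ̂_0, …, θ̂_n` for the data `z` and the noise realization `ξ`:
`θ̂_{i+1} = θ̂_i - γ_{i+1} (Ψ(θ̂_i, z_{i+1}) + (2 B₀ / μ_{i+1}) ξ_{i+1})`. The quantities indexed by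
`1, …, n` in the mathematical notation are indexed by `Fin n`, that is by `0, …, n - 1`. -/
def iterate {n p : ℕ} {Z : Type*}
    (Ψ : EuclideanSpace ℝ (Fin p) → Z → EuclideanSpace ℝ (Fin p)) (B₀ : ℝ) (γ μ : Fin n → ℝ)
    (θ₀ : EuclideanSpace ℝ (Fin p)) (z : Fin n → Z) (ξ : Fin n → EuclideanSpace ℝ (Fin p)) :
    Fin (n + 1) → EuclideanSpace ℝ (Fin p) :=
  Fin.induction θ₀ fun i θ => θ - γ i • (Ψ θ (z i) + (2 * B₀ / μ i) • ξ i)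

/-- The averaged output `(θ̂_1 + ⋯ + θ̂_n) / n`. -/
def average {n p : ℕ} {Z : Type*}
    (Ψ : EuclideanSpace ℝ (Fin p) → Z → EuclideanSpace ℝ (Fin p)) (B₀ : ℝ) (γ μ : Fin n → ℝ)
    (θ₀ : EuclideanSpace ℝ (Fin p)) (z : Fin n → Z) (ξ : Fin n → EuclideanSpace ℝ (Fin p)) :
    EuclideanSpace ℝ (Fin p) :=
  (n : ℝ)⁻¹ • ∑ i : Fin n, iterate Ψ B₀ γ μ θ₀ z ξ i.succ

end LDPSGD

end

namespace LDPSGD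

/-! Let the data differ only at index `i`, and let `m` be the largest `μ j`. Both runs agree before
step `i`, where their gradients differ by some `d` with `‖d‖ ≤ 2 * B₀`. So `d = (2 * B₀ / μ i) • m •
v`, where `‖v‖ ≤ 1` because `μ i ≤ m`, and `v` depends only on earlier noise. The noise of step `i`
can be generated as `x • v` plus an independent Gaussian with covariance `1 - v vᵀ`, where `x ~ N(0,
1)`. Replacing `x` by `x + m` then has the same effect on the output as replacing `z` by `z'`. Hence
both output laws come from `N(0, 1)` and `N(m, 1)` by one randomized map (`exists_map_average_eq`),
which cannot lower the trade-off function (`tradeoff_le_tradeoff_map`). -/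

/-- Trade-off functions do not decrease under randomized post-processing. -/
theorem tradeoff_le_tradeoff_map {X Y S : Type*} [MeasurableSpace X] [MeasurableSpace Y]
    [MeasurableSpace S] {P Q : Measure X} [IsProbabilityMeasure P] [IsProbabilityMeasure Q]
    {κ : Measure S} [IsProbabilityMeasure κ] {F : X × S → Y} (hF : Measurable F)
    {α : ℝ} (hα : 0 ≤ α) :
    tradeoff P Q α ≤ tradeoff ((P.prod κ).map F) ((Q.prod κ).map F) α := by
  refine csInf_le_csInf ⟨0, ?_⟩ ⟨_, 0, ⟨measurable_const, by simp⟩, by simpa using hα, rfl⟩ ?_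
  · rintro _ ⟨φ, hφ, -, rfl⟩
    exact integral_nonneg fun x => sub_nonneg.2 (hφ.2 x).2
  rintro _ ⟨φ, hφ, hle, rfl⟩
  have hm : Measurable fun q => φ (F q) := hφ.1.comp hF
  have hint (R : Measure (X × S)) [IsProbabilityMeasure R] : Integrable (fun q => φ (F q)) R :=
    .of_mem_Icc 0 1 hm.aemeasurable (.of_forall fun q => hφ.2 (F q))
  have hints (x : X) : Integrable (fun s => φ (F (x, s))) κ :=
    .of_mem_Icc 0 1 (hm.comp measurable_prodMk_left).aemeasurable (.of_forall fun s => hφ.2 _)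
  -- Averaging the test over the auxiliary randomness keeps both errors, by Fubini.
  refine ⟨fun x => ∫ s, φ (F (x, s)) ∂κ,
    ⟨hm.stronglyMeasurable.integral_prod_right'.measurable, fun x => ⟨?_, ?_⟩⟩, ?_, ?_⟩
  · exact integral_nonneg fun s => (hφ.2 _).1
  · simpa using integral_mono (hints x) (integrable_const 1) fun s => (hφ.2 (F (x, s))).2
  · rwa [← integral_prod _ (hint (P.prod κ)),
      ← integral_map hF.aemeasurable hφ.1.aestronglyMeasurable]
  · rw [integral_map hF.aemeasurable (f := fun y => 1 - φ y)
        (measurable_const.sub hφ.1).aestronglyMeasurable,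
      integral_prod (fun q => 1 - φ (F q)) ((integrable_const 1).sub (hint (Q.prod κ)))]
    refine integral_congr_ae (.of_forall fun x => ?_)
    simp [integral_sub (integrable_const 1) (hints x)]

section GaussianMix

variable {E : Type*} [NormedAddCommGroup E] [InnerProductSpace ℝ E]

/-- `x • v + (1 - v vᵀ)^{1/2} g`: for `‖v‖ ≤ 1` this turns a real and a vector-valued standard
Gaussian variable into a vector-valued one. -/
noncomputable def gaussianMix (v : E) (q : ℝ × E) : E :=
  q.1 • v + (q.2 - ((1 + √(1 - ‖v‖ ^ 2))⁻¹ * inner ℝ v q.2) • v)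

theorem gaussianMix_add (v g : E) (x y : ℝ) :
    gaussianMix v (x + y, g) = y • v + gaussianMix v (x, g) := by
  simp only [gaussianMix, add_smul]
  abel

/-- With `s = √(1 - ‖v‖ ^ 2)`, the map `t ↦ gaussianMix v (0, t)` scales `v` by `1 - ‖v‖ ^ 2 / (1 +
s) = s` and fixes the orthogonal complement of `v`, so its square is `1 - v vᵀ`. This form also
covers `v = 0`. -/
theorem norm_gaussianMix_sq {v : E} (hv : ‖v‖ ≤ 1) (t : E) :
    ‖gaussianMix v (0, t)‖ ^ 2 = ‖t‖ ^ 2 - inner ℝ v t ^ 2 := by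
  have hs : √(1 - ‖v‖ ^ 2) ^ 2 = 1 - ‖v‖ ^ 2 :=
    Real.sq_sqrt (by nlinarith [norm_nonneg v])
  have h0 := Real.sqrt_nonneg (1 - ‖v‖ ^ 2)
  unfold gaussianMix
  generalize √(1 - ‖v‖ ^ 2) = s at hs h0 ⊢
  have h1 : (1 + s) ≠ 0 := by positivity
  simp only [zero_smul, zero_add]
  rw [norm_sub_sq_real, norm_smul, mul_pow, Real.norm_eq_abs, sq_abs, real_inner_smul_right,
    real_inner_comm, show ‖v‖ ^ 2 = 1 - s ^ 2 by linarith]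
  field_simp
  ring

theorem inner_gaussianMix (v g t : E) (x : ℝ) :
    inner ℝ (gaussianMix v (x, g)) t = inner ℝ x (inner ℝ v t) +
      inner ℝ g (gaussianMix v (0, t)) := by
  simp only [gaussianMix, zero_smul, zero_add, inner_add_left, inner_sub_left, inner_sub_right,
    real_inner_smul_left, real_inner_smul_right, real_inner_comm v g]
  simp
  ring

variable [FiniteDimensional ℝ E] [MeasurableSpace E] [BorelSpace E]

theorem measurable_gaussianMix : Measurable fun r : E × ℝ × E => gaussianMix r.1 r.2 := by
  unfold gaussianMix
  fun_prop

/-- The two independent parts have covariances `v vᵀ` and `1 - v vᵀ`, which add up to the identity;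
the proof multiplies the characteristic functions. -/
theorem map_gaussianMix {v : E} (hv : ‖v‖ ≤ 1) :
    ((gaussianReal 0 1).prod (stdGaussian E)).map (gaussianMix v) = stdGaussian E := by
  have hm : Measurable (gaussianMix v) := measurable_gaussianMix.comp measurable_prodMk_left
  have := Measure.isProbabilityMeasure_map (μ := (gaussianReal 0 1).prod (stdGaussian E))
    hm.aemeasurable
  refine Measure.ext_of_charFun (funext fun t => ?_)
  rw [charFun_apply, integral_map hm.aemeasurable (by fun_prop), charFun_stdGaussian]
  have (q : ℝ × E) : Complex.exp (inner ℝ (gaussianMix v q) t * Complex.I) =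
      Complex.exp (inner ℝ q.1 (inner ℝ v t) * Complex.I) *
        Complex.exp (inner ℝ q.2 (gaussianMix v (0, t)) * Complex.I) := by
    rw [← Complex.exp_add, inner_gaussianMix]
    push_cast
    ring_nf
  simp_rw [this]
  rw [integral_prod_mul (fun x : ℝ => Complex.exp (inner ℝ x (inner ℝ v t) * Complex.I))
    (fun g : E => Complex.exp (inner ℝ g (gaussianMix v (0, t)) * Complex.I)),
    ← charFun_apply, ← charFun_apply, charFun_stdGaussian, charFun_gaussianReal,
    ← Complex.exp_add, ← Complex.ofReal_pow ‖gaussianMix v (0, t)‖, norm_gaussianMix_sq hv]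
  congr 1
  push_cast
  ring

end GaussianMix

/-- Resampling the coordinate `i` of a product measure by a map `T` that depends on the other
coordinates only and has law `ρ i` for each value of these preserves the product measure. -/
theorem measurePreserving_update {n : ℕ} {A E : Type*} [MeasurableSpace A] [MeasurableSpace E]
    [Inhabited E] (κ : Measure A) [SigmaFinite κ] (ρ : Fin n → Measure E) [∀ i, SigmaFinite (ρ i)]
    (i : Fin n) {T : (Fin n → E) → A × E → E} (hT : Measurable (Function.uncurry T))
    (hTi : ∀ ξ y, T (Function.update ξ i y) = T ξ)
    (hTρ : ∀ ξ, (κ.prod (ρ i)).map (T ξ) = ρ i) :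
    MeasurePreserving (fun q : A × (Fin n → E) => Function.update q.2 i (T q.2 (q.1, q.2 i)))
      (κ.prod (Measure.pi ρ)) (Measure.pi ρ) := by
  obtain _ | m := n
  · exact i.elim0
  let e := MeasurableEquiv.piFinSuccAbove (fun _ : Fin (m + 1) => E) i
  have he : MeasurePreserving e _ _ := measurePreserving_piFinSuccAbove ρ i
  let ρ' := Measure.pi fun j => ρ (i.succAbove j)
  -- `T` ignores coordinate `i`, so `default` can fill that slot.
  have hskew : MeasurePreserving
      (fun r : (Fin m → E) × A × E => (r.1, T (e.symm (default, r.1)) r.2))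
      (ρ'.prod (κ.prod (ρ i))) (ρ'.prod (ρ i)) := by
    refine (MeasurePreserving.id ρ').skew_product (g := fun w => T (e.symm (default, w)))
      (hT.comp (?_ : Measurable fun r : (Fin m → E) × A × E => (e.symm (default, r.1), r.2)))
      (.of_forall fun w => hTρ _)
    exact (e.symm.measurable.comp (measurable_const.prodMk measurable_fst)).prodMk measurable_snd
  have hassoc : MeasurePreserving (MeasurableEquiv.prodAssoc (α := A) (β := E) (γ := Fin m → E))
      ((κ.prod (ρ i)).prod ρ') (κ.prod ((ρ i).prod ρ')) := measurePreserving_prodAssoc _ _ _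
  convert (he.symm.comp Measure.measurePreserving_swap).comp (hskew.comp
    (Measure.measurePreserving_swap.comp (hassoc.symm.comp
      ((MeasurePreserving.id κ).prod he)))) using 1
  funext ⟨a, ξ⟩
  have h1 (y : E) : e.symm (y, i.removeNth ξ) = Function.update ξ i y := by
    rw [← Fin.insertNth_removeNth i y ξ]
    rfl
  have h2 : e ξ = (ξ i, i.removeNth ξ) := rfl
  simp [h2, h1, hTi, MeasurableEquiv.prodAssoc]

section Iterate

variable {n p : ℕ} {Z : Type*} {Ψ : EuclideanSpace ℝ (Fin p) → Z → EuclideanSpace ℝ (Fin p)}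
  {B₀ : ℝ} {γ μ : Fin n → ℝ} {θ₀ : EuclideanSpace ℝ (Fin p)}

theorem iterate_succ (z : Fin n → Z) (ξ : Fin n → EuclideanSpace ℝ (Fin p)) (i : Fin n) :
    iterate Ψ B₀ γ μ θ₀ z ξ i.succ = iterate Ψ B₀ γ μ θ₀ z ξ i.castSucc -
      γ i • (Ψ (iterate Ψ B₀ γ μ θ₀ z ξ i.castSucc) (z i) + (2 * B₀ / μ i) • ξ i) :=
  rfl

theorem measurable_iterate (hΨ : ∀ z, Measurable fun θ => Ψ θ z) (z : Fin n → Z)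
    (j : Fin (n + 1)) : Measurable fun ξ => iterate Ψ B₀ γ μ θ₀ z ξ j := by
  induction j using Fin.induction with
  | zero => exact measurable_const
  | succ i ih =>
    have := (hΨ (z i)).comp ih
    simp only [iterate_succ]
    fun_prop

theorem measurable_average (hΨ : ∀ z, Measurable fun θ => Ψ θ z) (z : Fin n → Z) :
    Measurable fun ξ => average Ψ B₀ γ μ θ₀ z ξ := by
  have := measurable_iterate (B₀ := B₀) (γ := γ) (μ := μ) (θ₀ := θ₀) hΨ z
  unfold average
  fun_prop

/-- Runs whose noisy gradients agree before time `j` agree at time `j`. -/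
theorem iterate_congr {z z' : Fin n → Z} {ξ ξ' : Fin n → EuclideanSpace ℝ (Fin p)}
    (j : Fin (n + 1))
    (h : ∀ k : Fin n, k.castSucc < j →
      Ψ (iterate Ψ B₀ γ μ θ₀ z ξ k.castSucc) (z k) + (2 * B₀ / μ k) • ξ k =
        Ψ (iterate Ψ B₀ γ μ θ₀ z ξ k.castSucc) (z' k) + (2 * B₀ / μ k) • ξ' k) :
    iterate Ψ B₀ γ μ θ₀ z ξ j = iterate Ψ B₀ γ μ θ₀ z' ξ' j := by
  induction j using Fin.induction with
  | zero => rfl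
  | succ i ih =>
    rw [iterate_succ, iterate_succ, h i i.castSucc_lt_succ,
      ih fun k hk => h k (hk.trans i.castSucc_lt_succ)]

theorem iterate_castSucc_update (z : Fin n → Z) (ξ : Fin n → EuclideanSpace ℝ (Fin p))
    (i : Fin n) (y : EuclideanSpace ℝ (Fin p)) :
    iterate Ψ B₀ γ μ θ₀ z (Function.update ξ i y) i.castSucc =
      iterate Ψ B₀ γ μ θ₀ z ξ i.castSucc := by
  refine (iterate_congr _ fun k hk => ?_).symm
  rw [Function.update_of_ne (Fin.castSucc_lt_castSucc_iff.1 hk).ne]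

/-- Shifting the noise at the only time at which the data differ compensates for the difference of
the gradients. -/
theorem average_update_add {z z' : Fin n → Z} {i : Fin n} (hz : ∀ j, j ≠ i → z j = z' j)
    {ξ : Fin n → EuclideanSpace ℝ (Fin p)} {w : EuclideanSpace ℝ (Fin p)}
    (hw : (2 * B₀ / μ i) • w = Ψ (iterate Ψ B₀ γ μ θ₀ z ξ i.castSucc) (z' i) -
      Ψ (iterate Ψ B₀ γ μ θ₀ z ξ i.castSucc) (z i)) (y : EuclideanSpace ℝ (Fin p)) :
    average Ψ B₀ γ μ θ₀ z (Function.update ξ i (w + y)) =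
      average Ψ B₀ γ μ θ₀ z' (Function.update ξ i y) := by
  unfold average
  congr 1
  refine Finset.sum_congr rfl fun j _ => iterate_congr _ fun k _ => ?_
  obtain rfl | hk := eq_or_ne k i
  · rw [iterate_castSucc_update, Function.update_self, Function.update_self, smul_add, hw]
    abel
  · rw [Function.update_of_ne hk, Function.update_of_ne hk, hz k hk]

end Iterate

/-- The cut-off to `0` outside the closed unit ball. -/
noncomputable def cutoff {E : Type*} [NormedAddCommGroup E] (v : E) : E :=
  open Classical in if ‖v‖ ≤ 1 then v else 0

theorem norm_cutoff_le {E : Type*} [NormedAddCommGroup E] (v : E) : ‖cutoff v‖ ≤ 1 := by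
  unfold cutoff
  split_ifs with h <;> simp [h]

theorem measurable_cutoff {E : Type*} [NormedAddCommGroup E] [MeasurableSpace E]
    [OpensMeasurableSpace E] : Measurable (cutoff : E → E) :=
  Measurable.ite (measurableSet_le measurable_norm measurable_const) measurable_id measurable_const

/-- The one-step Gaussian mechanism inside the algorithm: if the gradients at the differing data
point are bounded along the run, both output laws arise from `N(0, 1)` and `N(m, 1)` by the same
randomized post-processing. -/
theorem exists_map_average_eq {n p : ℕ} {Z : Type*}
    {Ψ : EuclideanSpace ℝ (Fin p) → Z → EuclideanSpace ℝ (Fin p)}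
    (hΨ : ∀ z, Measurable fun θ => Ψ θ z) {B₀ : ℝ} (hB₀ : 0 < B₀) (γ : Fin n → ℝ) {μ : Fin n → ℝ}
    (θ₀ : EuclideanSpace ℝ (Fin p)) {z z' : Fin n → Z} {i : Fin n}
    (hz : ∀ j, j ≠ i → z j = z' j) (hμ : 0 < μ i) {m : ℝ} (hm : μ i ≤ m)
    {ν : Measure (Fin n → EuclideanSpace ℝ (Fin p))}
    (hν : ν = Measure.pi fun _ => stdGaussian (EuclideanSpace ℝ (Fin p)))
    (hb : ∀ᵐ ξ ∂ν, ‖Ψ (iterate Ψ B₀ γ μ θ₀ z ξ i.castSucc) (z i)‖ ≤ B₀ ∧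
      ‖Ψ (iterate Ψ B₀ γ μ θ₀ z ξ i.castSucc) (z' i)‖ ≤ B₀) :
    ∃ F : ℝ × (Fin n → EuclideanSpace ℝ (Fin p)) → EuclideanSpace ℝ (Fin p), Measurable F ∧
      ν.map (average Ψ B₀ γ μ θ₀ z) = ((gaussianReal 0 1).prod ν).map F ∧
      ν.map (average Ψ B₀ γ μ θ₀ z') = ((gaussianReal m 1).prod ν).map F := by
  have : IsProbabilityMeasure ν := hν ▸ inferInstance
  have hm0 : 0 < m := hμ.trans_le hm
  let d (ξ : Fin n → EuclideanSpace ℝ (Fin p)) : EuclideanSpace ℝ (Fin p) :=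
    Ψ (iterate Ψ B₀ γ μ θ₀ z ξ i.castSucc) (z' i) - Ψ (iterate Ψ B₀ γ μ θ₀ z ξ i.castSucc) (z i)
  have hd : Measurable d :=
    ((hΨ (z' i)).comp (measurable_iterate hΨ z _)).sub
      ((hΨ (z i)).comp (measurable_iterate hΨ z _))
  -- The bound on `d` holds only almost surely, whereas `map_gaussianMix` is needed for every `ξ`;
  -- hence the cut-off.
  let v (ξ : Fin n → EuclideanSpace ℝ (Fin p)) := cutoff ((m * (2 * B₀ / μ i))⁻¹ • d ξ)
  have hv : Measurable v := measurable_cutoff.comp (by fun_prop)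
  have hvd : ∀ᵐ ξ ∂ν, (2 * B₀ / μ i) • m • v ξ = d ξ := by
    filter_upwards [hb] with ξ hξ
    have hle : ‖d ξ‖ ≤ 2 * B₀ := (norm_sub_le _ _).trans (by linarith)
    have h1 : ‖(m * (2 * B₀ / μ i))⁻¹ • d ξ‖ ≤ 1 := by
      rw [norm_smul, Real.norm_of_nonneg (by positivity), inv_mul_le_one₀ (by positivity)]
      refine hle.trans ?_
      rw [mul_div_assoc', le_div_iff₀ hμ, mul_comm]
      gcongr
    simp only [v, cutoff, if_pos h1]
    rw [smul_smul, smul_smul, mul_comm _ m, mul_inv_cancel₀ (by positivity), one_smul]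
  let U (q : ℝ × (Fin n → EuclideanSpace ℝ (Fin p))) :=
    Function.update q.2 i (gaussianMix (v q.2) (q.1, q.2 i))
  have hU : MeasurePreserving U ((gaussianReal 0 1).prod ν) ν := by
    subst hν
    refine measurePreserving_update (gaussianReal 0 1) (fun _ => stdGaussian _) i
      (T := fun ξ => gaussianMix (v ξ)) ?_ (fun ξ y => ?_) fun ξ => map_gaussianMix (norm_cutoff_le _)
    · exact measurable_gaussianMix.comp
        ((hv.comp measurable_fst).prodMk measurable_snd)
    -- The direction is determined by the noise before step `i`, so resampling coordinate `i` leaves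
    -- it unchanged.
    · simp only [v, d, iterate_castSucc_update]
  have hF : Measurable fun q => average Ψ B₀ γ μ θ₀ z (U q) :=
    (measurable_average hΨ z).comp hU.measurable
  refine ⟨fun q => average Ψ B₀ γ μ θ₀ z (U q), hF, ?_, ?_⟩
  · rw [← hU.map_eq, Measure.map_map (measurable_average hΨ z) hU.measurable, hU.map_eq]
    rfl
  · have hshift : MeasurePreserving (Prod.map (· + m) id)
        ((gaussianReal 0 1).prod ν) ((gaussianReal m 1).prod ν) :=
      MeasurePreserving.prod ⟨by fun_prop, by rw [gaussianReal_map_add_const, zero_add]⟩ (.id ν)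
    rw [← hshift.map_eq, Measure.map_map hF hshift.measurable]
    conv_lhs => rw [← hU.map_eq]
    rw [Measure.map_map (measurable_average hΨ z') hU.measurable]
    -- Over `N(0, 1) ⊗ ν`, it remains to compare the outputs pointwise: adding `m` to `x` adds `m •
    -- v` to the noise, which turns the run on `z` into the run on `z'`.
    refine Measure.map_congr ?_
    filter_upwards [Measure.quasiMeasurePreserving_snd.ae hvd] with q hq
    simp only [Function.comp, U, Prod.map_fst, Prod.map_snd, id, gaussianMix_add]
    exact (average_update_add hz hq _).symm

end LDPSGD

theorem proposition5 {n p : ℕ} [NeZero n] {Z Ω : Type*} [MeasurableSpace Ω]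
    (P : Measure Ω) [IsProbabilityMeasure P]
    (Θ : Set (EuclideanSpace ℝ (Fin p)))
    (Ψ : EuclideanSpace ℝ (Fin p) → Z → EuclideanSpace ℝ (Fin p))
    (hΨ : ∀ z, Measurable fun θ => Ψ θ z)
    (B₀ : ℝ) (hB₀ : 0 < B₀) (hbound : ∀ θ ∈ Θ, ∀ z, ‖Ψ θ z‖ ≤ B₀)
    (γ μ : Fin n → ℝ) (hμ : ∀ i, 0 < μ i)
    (θ₀ : EuclideanSpace ℝ (Fin p))
    (ξ : Fin n → Ω → EuclideanSpace ℝ (Fin p))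
    (hξ : ∀ i, HasLaw (ξ i) (stdGaussian (EuclideanSpace ℝ (Fin p))) P)
    (hindep : iIndepFun ξ P)
    -- the points at which the gradient is evaluated lie in `Θ` (automatic for `Θ = Set.univ`)
    (hΘ : ∀ (z : Fin n → Z) (i : Fin n),
      ∀ᵐ ω ∂P, LDPSGD.iterate Ψ B₀ γ μ θ₀ z (fun j => ξ j ω) i.castSucc ∈ Θ) :
    LDPSGD.IsGDP (Finset.univ.sup' Finset.univ_nonempty μ)
      (fun z : Fin n → Z => P.map fun ω => LDPSGD.average Ψ B₀ γ μ θ₀ z fun j => ξ j ω) := by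
  rintro z z' ⟨i, hz⟩ α hα
  have hlaw := hindep.hasLaw_pi hξ
  have hM (y : Fin n → Z) : (P.map fun ω => LDPSGD.average Ψ B₀ γ μ θ₀ y fun j => ξ j ω) =
      (Measure.pi fun _ => stdGaussian _).map (LDPSGD.average Ψ B₀ γ μ θ₀ y) := by
    rw [← hlaw.map_eq, AEMeasurable.map_map_of_aemeasurable
      (LDPSGD.measurable_average hΨ y).aemeasurable hlaw.aemeasurable]
    rfl
  have hnorm (y : Z) : Measurable fun x : Fin n → EuclideanSpace ℝ (Fin p) =>
      ‖Ψ (LDPSGD.iterate Ψ B₀ γ μ θ₀ z x i.castSucc) y‖ :=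
    ((hΨ y).comp (LDPSGD.measurable_iterate hΨ z _)).norm
  obtain ⟨F, hF, h0, h1⟩ := LDPSGD.exists_map_average_eq hΨ hB₀ γ θ₀ hz (hμ i)
    (Finset.le_sup' μ (Finset.mem_univ i)) rfl (by
      rw [← hlaw.map_eq]
      refine (ae_map_iff hlaw.aemeasurable
        ((measurableSet_le (hnorm (z i)) measurable_const).inter
          (measurableSet_le (hnorm (z' i)) measurable_const))).2 ?_
      filter_upwards [hΘ z i] with ω hω
      exact ⟨hbound _ hω _, hbound _ hω _⟩)
  simp only [hM, h0, h1]
  exact LDPSGD.tradeoff_le_tradeoff_map hF hα.1
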